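/- Let $M\ge 2$ be an integer and $p\in[0,1]$. For $j\in\{0,\dots,M-1\}$ let $\phi_j(x)=(x+j)/M$, and for a finite word $\sigma=\sigma_1\cdots\sigma_n$ over $\{0,\dots,M-1\}$ let $J_\sigma=\phi_{\sigma_1}\circ\cdots\circ\phi_{\sigma_n}([0,1])$ (so $J_\varepsilon=[0,1]$ for the empty word $\varepsilon$). A fractal percolation $K$ on $[0,1]$ with parameters $M$ and $p$ is generated by random index sets $I_\sigma\subseteq\{0,\dots,M-1\}$, one for each finite word $\sigma$, such that the events $\{j\in I_\sigma\}$, over all $\sigma$ and $j$, are independent and each has probability $p$: one puts $\mathcal T_0=\{\varepsilon\}$, $\mathcal T_{n+1}=\{\sigma i:\sigma\in\mathcal T_n,\ i\in I_\sigma\}$, $K_n=\bigcup_{\sigma\in\mathcal T_n}J_\sigma$ and $K=\bigcap_{n\ge 0}K_n$. Let $K^{(1)},K^{(2)}$ be independent fractal percolations on $[0,1]$ (that is, generated by two independent families of index sets) with the same parameters $M$ and $p$. If $p\le 1/\sqrt M$, then $K^{(1)}\cap K^{(2)}$ is almost surely empty. If $p>1/\sqrt M$, then $\{K^{(1)}\cap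 K^{(2)}\ne\emptyset\}$ is an event of positive probability and, conditioned on this event, the Hausdorff dimension of $K^{(1)}\cap K^{(2)}$ is almost surely equal to $$D'=\frac{\log (Mp^2)}{\log M}.$$ -/

import Mathlib

namespace FractalPercolation

open MeasureTheory ProbabilityTheory

/-- The similarity `φ_j(x) = (x + j) / M` (with `j = 0, …, M - 1`), which maps `[0,1]` onto its
`j`-th subinterval `[j/M, (j+1)/M]`. -/
noncomputable def phi (M : ℕ) (j : Fin M) (x : ℝ) : ℝ := (x + (j : ℕ)) / M

/-- The basic interval `J_σ = φ_{σ₁} ∘ φ_{σ₂} ∘ ⋯ ∘ φ_{σₙ} ([0,1])` of a finite word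
`σ = σ₁σ₂…σₙ`; here `J_ε = [0,1]` for the empty word. -/
noncomputable def basicInterval (M : ℕ) : List (Fin M) → Set ℝ
  | [] => Set.Icc 0 1
  | j :: σ => phi M j '' basicInterval M σ

/-- The `n`-th generation `T_n` of the tree determined by the index sets `I_σ ⊆ {0, …, M-1}`:
`T_0 = {ε}` and `T_{n+1} = {σi : σ ∈ T_n, i ∈ I_σ}`. -/
def generation {M : ℕ} (I : List (Fin M) → Set (Fin M)) : ℕ → Set (List (Fin M))
  | 0 => {[]}
  | n + 1 => {τ | ∃ σ ∈ generation I n, ∃ i ∈ I σ, τ = σ ++ [i]}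

/-- The `n`-th construction step `K_n = ⋃_{σ ∈ T_n} J_σ`. -/
noncomputable def constructionStep {M : ℕ} (I : List (Fin M) → Set (Fin M)) (n : ℕ) : Set ℝ :=
  ⋃ σ ∈ generation I n, basicInterval M σ

/-- The limit set `K = ⋂ₙ K_n`. -/
noncomputable def limitSet {M : ℕ} (I : List (Fin M) → Set (Fin M)) : Set ℝ :=
  ⋂ n : ℕ, constructionStep I n

/-- The random index sets `I σ`, indexed by the finite words `σ`, generate a fractal percolation
on `[0,1]` with parameters `M` and `p` under the probability measure `P`: every index `j` belongs
to `I σ` with probability `p`, independently for all pairs `(σ, j)`. The fractal percolation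
itself is the random set `ω ↦ limitSet (fun σ => I σ ω)`. -/
structure IsFractalPercolation {Ω : Type*} [MeasurableSpace Ω] (P : Measure Ω) (M : ℕ) (p : ℝ)
    (I : List (Fin M) → Ω → Set (Fin M)) : Prop where
  measurable : ∀ σ, Measurable (I σ)
  prob_mem : ∀ σ j, P {ω | j ∈ I σ ω} = ENNReal.ofReal p
  indep : iIndepSet (fun e : List (Fin M) × Fin M => {ω | e.2 ∈ I e.1 ω}) P

end FractalPercolation

/-! Intersecting the two families of index sets gives a percolation tree with parameter `q = p ^ 2`.
If `p < 1`, a fixed point is almost surely not in K₁, so K₁ contains no rational; distinct basic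
intervals of one level meet only in rational endpoints, hence K₁ ∩ K₂ is almost surely the limit set
of the intersected tree (`ae_limitSet_inter_eq`). By compactness it is nonempty iff that tree is
infinite, a Galton–Watson question with generating function f(x) = (1 - q + q x)^M: extinction is
almost sure when Mq ≤ 1 (`eq_one_of_fixedPoint`), while survival has positive probability when Mq >
1 (`measure_survives_pos`).

The upper bound for the dimension is a first-moment estimate on the natural covers
(`ae_hausdorffMeasure_eq_zero`). The lower bound uses an independent percolation with parameter r =
M⁻ˢ as a test: it almost surely misses every set of zero s-dimensional Hausdorff measure
(`measure_hit_eq_zero`). If M^s < Mq, the tree thinned by it is still supercritical. "The thinned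
tree almost surely dies" is a property that a tree has iff all its first-generation subtrees have
it, so its probability is a fixed point of f below 1. By strict convexity there is only one such
fixed point (`fixedPoint_unique`), the extinction probability. So almost surely on survival the test
percolation hits the limit set with positive probability, and the Hausdorff measure is nonzero. -/

namespace FractalPercolation

open MeasureTheory ProbabilityTheory Set

variable {M : ℕ}

/-! ### Trees and their survival. -/

/-- The index sets of the subtree hanging at the first-generation vertex `j`. -/
def subtreeAt (I : List (Fin M) → Set (Fin M)) (j : Fin M) : List (Fin M) → Set (Fin M) :=
  fun σ => I (j :: σ)

/-- The tree determined by the index sets is infinite. -/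
def Survives (I : List (Fin M) → Set (Fin M)) : Prop := ∀ n, (generation I n).Nonempty

theorem length_of_mem_generation {I : List (Fin M) → Set (Fin M)} {n : ℕ} {σ : List (Fin M)}
    (h : σ ∈ generation I n) : σ.length = n := by
  induction n generalizing σ with
  | zero => rw [generation, mem_singleton_iff] at h; simp [h]
  | succ n ih =>
    obtain ⟨τ, hτ, i, -, rfl⟩ := h
    simp [ih hτ]

theorem cons_mem_generation_succ {I : List (Fin M) → Set (Fin M)} {n : ℕ} {j : Fin M}
    {τ : List (Fin M)} :
    j :: τ ∈ generation I (n + 1) ↔ j ∈ I [] ∧ τ ∈ generation (subtreeAt I j) n := by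
  induction n generalizing τ with
  | zero =>
    constructor
    · rintro ⟨σ, hσ, i, hi, h⟩
      rw [generation, mem_singleton_iff] at hσ
      subst hσ
      simp only [List.nil_append, List.cons.injEq] at h
      obtain ⟨rfl, rfl⟩ := h
      exact ⟨hi, rfl⟩
    · rintro ⟨hj, hτ⟩
      rw [generation, mem_singleton_iff] at hτ
      subst hτ
      exact ⟨[], rfl, j, hj, rfl⟩
  | succ n ih =>
    constructor
    · rintro ⟨σ, hσ, i, hi, h⟩
      cases σ with
      | nil => simpa using length_of_mem_generation hσ
      | cons a σ =>
        simp only [List.cons_append, List.cons.injEq] at h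
        obtain ⟨rfl, rfl⟩ := h
        have := ih.1 hσ
        exact ⟨this.1, σ, this.2, i, hi, rfl⟩
    · rintro ⟨hj, σ, hσ, i, hi, rfl⟩
      exact ⟨j :: σ, ih.2 ⟨hj, hσ⟩, i, hi, rfl⟩

theorem generation_succ_nonempty {I : List (Fin M) → Set (Fin M)} {n : ℕ} :
    (generation I (n + 1)).Nonempty ↔ ∃ j ∈ I [], (generation (subtreeAt I j) n).Nonempty := by
  constructor
  · rintro ⟨σ, hσ⟩
    cases σ with
    | nil => simpa using length_of_mem_generation hσ
    | cons j τ =>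
      have := cons_mem_generation_succ.1 hσ
      exact ⟨j, this.1, τ, this.2⟩
  · rintro ⟨j, hj, τ, hτ⟩
    exact ⟨j :: τ, cons_mem_generation_succ.2 ⟨hj, hτ⟩⟩

theorem generation_nonempty_antitone {I : List (Fin M) → Set (Fin M)} {m n : ℕ} (hmn : m ≤ n)
    (h : (generation I n).Nonempty) : (generation I m).Nonempty := by
  induction n, hmn using Nat.le_induction with
  | base => exact h
  | succ n _ ih =>
    obtain ⟨_, σ, hσ, -⟩ := h
    exact ih ⟨σ, hσ⟩

/-- König's argument: there are finitely many children, so if every child's subtree dies, a common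
level bounds all their extinction times. -/
theorem survives_iff {I : List (Fin M) → Set (Fin M)} :
    Survives I ↔ ∃ j ∈ I [], Survives (subtreeAt I j) := by
  constructor
  · intro h
    by_contra! hc
    have : ∀ j ∈ I [], ∃ n, ¬ (generation (subtreeAt I j) n).Nonempty := fun j hj => by
      simpa [Survives] using hc j hj
    choose! N hN using this
    obtain ⟨j, hj, hne⟩ := generation_succ_nonempty.1 (h (Finset.univ.sup N + 1))
    exact hN j hj (generation_nonempty_antitone (Finset.le_sup (Finset.mem_univ j)) hne)
  · rintro ⟨j, hj, h⟩ n
    exact generation_nonempty_antitone n.le_succ (generation_succ_nonempty.2 ⟨j, hj, h n⟩)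

theorem generation_mono {I I' : List (Fin M) → Set (Fin M)} (h : ∀ σ, I σ ⊆ I' σ) (n : ℕ) :
    generation I n ⊆ generation I' n := by
  induction n with
  | zero => exact subset_rfl
  | succ n ih =>
    rintro _ ⟨σ, hσ, i, hi, rfl⟩
    exact ⟨σ, ih hσ, i, h σ hi, rfl⟩

theorem generation_inter (I I' : List (Fin M) → Set (Fin M)) (n : ℕ) :
    generation (fun σ => I σ ∩ I' σ) n = generation I n ∩ generation I' n := by
  refine Subset.antisymm (subset_inter (generation_mono (fun _ => inter_subset_left) n)
    (generation_mono (fun _ => inter_subset_right) n)) ?_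
  induction n with
  | zero => exact inter_subset_left
  | succ n ih =>
    rintro _ ⟨⟨σ, hσ, i, hi, rfl⟩, τ, hτ, j, hj, h⟩
    obtain ⟨rfl, h'⟩ := List.append_inj' h rfl
    obtain rfl : i = j := by simpa using h'
    exact ⟨σ, ih ⟨hσ, hτ⟩, i, ⟨hi, hj⟩, rfl⟩

theorem finite_generation (I : List (Fin M) → Set (Fin M)) (n : ℕ) : (generation I n).Finite :=
  (List.finite_length_eq (Fin M) n).subset fun _ h => length_of_mem_generation h

theorem limitSet_mono {I I' : List (Fin M) → Set (Fin M)} (h : ∀ σ, I σ ⊆ I' σ) :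
    limitSet I ⊆ limitSet I' :=
  iInter_mono fun n => biUnion_subset_biUnion_left (generation_mono h n)

/-! ### Geometry of the basic intervals through base-`M` codes. -/

/-- The integer whose base-`M` digits, most significant first, are the letters of the word. -/
def code (M : ℕ) : List (Fin M) → ℕ
  | [] => 0
  | j :: σ => j * M ^ σ.length + code M σ

theorem code_lt (σ : List (Fin M)) : code M σ < M ^ σ.length := by
  induction σ with
  | nil => simp [code]
  | cons j σ ih =>
    have hj : (j : ℕ) + 1 ≤ M := j.2
    calc code M (j :: σ) < j * M ^ σ.length + M ^ σ.length := by simpa [code] using ih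
      _ = (j + 1) * M ^ σ.length := by ring
      _ ≤ M * M ^ σ.length := Nat.mul_le_mul_right _ hj
      _ = M ^ (j :: σ).length := by rw [List.length_cons, pow_succ']

theorem code_injective (hM : 0 < M) {σ τ : List (Fin M)} (hl : σ.length = τ.length)
    (h : code M σ = code M τ) : σ = τ := by
  induction σ generalizing τ with
  | nil => exact (List.length_eq_zero_iff.1 hl.symm).symm
  | cons j σ ih =>
    cases τ with
    | nil => simp at hl
    | cons i τ =>
      have hl' : σ.length = τ.length := by simpa using hl
      have h1 := code_lt σ
      have h2 := code_lt τ
      simp only [code, hl'] at h h1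
      have hpos : 0 < M ^ τ.length := pow_pos hM _
      have hji : (j : ℕ) = i := by
        have := congrArg (· / M ^ τ.length) h
        simpa [mul_comm _ (M ^ τ.length), Nat.mul_add_div hpos, Nat.div_eq_of_lt h1,
          Nat.div_eq_of_lt h2] using this
      rw [hji] at h
      rw [Fin.ext hji, ih hl' (by omega)]

theorem basicInterval_eq (hM : 0 < M) (σ : List (Fin M)) :
    basicInterval M σ =
      Icc ((code M σ : ℝ) / M ^ σ.length) (((code M σ : ℝ) + 1) / M ^ σ.length) := by
  induction σ with
  | nil => simp [basicInterval, code]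
  | cons j σ ih =>
    have hM' : (0 : ℝ) < M := by exact_mod_cast hM
    have hphi : phi M j = fun x => (M : ℝ)⁻¹ * x + (j : ℕ) / M := by
      ext x; simp only [phi]; ring
    rw [basicInterval, ih, hphi, image_affine_Icc' (by positivity)]
    simp only [code, List.length_cons]
    push_cast
    congr 1 <;> field_simp <;> ring

theorem basicInterval_append_subset (hM : 0 < M) (σ : List (Fin M)) (i : Fin M) :
    basicInterval M (σ ++ [i]) ⊆ basicInterval M σ := by
  induction σ with
  | nil =>
    have hM' : (0 : ℝ) < M := by exact_mod_cast hM
    have hi : ((i : ℕ) : ℝ) + 1 ≤ M := by exact_mod_cast i.2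
    rw [List.nil_append, basicInterval_eq hM, basicInterval]
    apply Icc_subset_Icc
    · positivity
    · simpa [code, div_le_one hM'] using hi
  | cons j σ ih => exact image_mono ih

theorem isCompact_basicInterval (hM : 0 < M) (σ : List (Fin M)) :
    IsCompact (basicInterval M σ) := by
  rw [basicInterval_eq hM]; exact isCompact_Icc

theorem isCompact_constructionStep (hM : 0 < M) (I : List (Fin M) → Set (Fin M)) (n : ℕ) :
    IsCompact (constructionStep I n) :=
  (finite_generation I n).isCompact_biUnion fun σ _ => isCompact_basicInterval hM σ

theorem constructionStep_succ_subset (hM : 0 < M) (I : List (Fin M) → Set (Fin M)) (n : ℕ) :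
    constructionStep I (n + 1) ⊆ constructionStep I n := by
  refine iUnion₂_subset ?_
  rintro _ ⟨σ, hσ, i, -, rfl⟩
  exact (basicInterval_append_subset hM σ i).trans (subset_biUnion_of_mem (u := basicInterval M) hσ)

/-- Cantor's intersection theorem. It serves both the survival criterion (with `I = I'`) and the
measurability of the nonemptiness event. -/
theorem limitSet_inter_nonempty_iff (hM : 0 < M) (I I' : List (Fin M) → Set (Fin M)) :
    (limitSet I ∩ limitSet I').Nonempty ↔
      ∀ n, (constructionStep I n ∩ constructionStep I' n).Nonempty := by
  rw [limitSet, limitSet, ← iInter_inter_distrib]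
  refine ⟨fun ⟨x, hx⟩ n => ⟨x, mem_iInter.1 hx n⟩, fun h => ?_⟩
  exact IsCompact.nonempty_iInter_of_sequence_nonempty_isCompact_isClosed _
    (fun n => inter_subset_inter (constructionStep_succ_subset hM I n)
      (constructionStep_succ_subset hM I' n)) h
    ((isCompact_constructionStep hM I 0).inter (isCompact_constructionStep hM I' 0))
    fun n => ((isCompact_constructionStep hM I n).inter (isCompact_constructionStep hM I' n)).isClosed

theorem basicInterval_nonempty (hM : 0 < M) (σ : List (Fin M)) :
    (basicInterval M σ).Nonempty := by
  rw [basicInterval_eq hM, nonempty_Icc]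
  gcongr
  linarith

theorem limitSet_nonempty_iff (hM : 0 < M) (I : List (Fin M) → Set (Fin M)) :
    (limitSet I).Nonempty ↔ Survives I := by
  rw [← inter_self (limitSet I), limitSet_inter_nonempty_iff hM]
  refine forall_congr' fun n => ?_
  rw [inter_self, constructionStep, nonempty_biUnion]
  exact ⟨fun ⟨σ, hσ, _⟩ => ⟨σ, hσ⟩, fun ⟨σ, hσ⟩ => ⟨σ, hσ, basicInterval_nonempty hM σ⟩⟩

/-- A set of diameter at most `M⁻ⁿ` meets at most four basic intervals of generation `n`. -/
theorem card_hit_le (hM : 0 < M) {n : ℕ} {u : ℝ} (s : Finset (List.Vector (Fin M) n))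
    (hs : ∀ σ ∈ s, ∃ x ∈ basicInterval M σ.toList, |x - u| ≤ ((M : ℝ) ^ n)⁻¹) : s.card ≤ 4 := by
  have hMn : (0 : ℝ) < (M : ℝ) ^ n := by positivity
  -- After scaling by `M ^ n` the interval is [k, k + 1] and has a point within 1 of v = u Mⁿ, so v
  -- - 2 ≤ k ≤ v + 1.
  have key : ∀ σ ∈ s, (code M σ.toList : ℤ) ∈ Finset.Icc (⌈u * M ^ n⌉ - 2) (⌈u * M ^ n⌉ + 1) := by
    intro σ hσ
    obtain ⟨x, hx, hxu⟩ := hs σ hσ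
    rw [basicInterval_eq hM, List.Vector.toList_length, mem_Icc, div_le_iff₀ hMn, le_div_iff₀ hMn] at hx
    have h1 : |x * M ^ n - u * M ^ n| ≤ 1 := by
      rw [← sub_mul, abs_mul, abs_of_pos hMn]
      calc _ ≤ ((M : ℝ) ^ n)⁻¹ * M ^ n := by gcongr
        _ = 1 := inv_mul_cancel₀ hMn.ne'
    rw [abs_le] at h1
    rw [Finset.mem_Icc]
    constructor
    · have : ⌈u * (M : ℝ) ^ n⌉ ≤ (code M σ.toList : ℤ) + 2 := by
        rw [Int.ceil_le]; push_cast; linarith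
      linarith
    · have h2 := Int.le_ceil (u * (M : ℝ) ^ n)
      have : ((code M σ.toList : ℤ) : ℝ) ≤ ((⌈u * (M : ℝ) ^ n⌉ + 1 : ℤ) : ℝ) := by
        push_cast; linarith
      exact_mod_cast this
  calc s.card ≤ (Finset.Icc (⌈u * (M : ℝ) ^ n⌉ - 2) (⌈u * (M : ℝ) ^ n⌉ + 1)).card := by
        refine Finset.card_le_card_of_injOn (fun σ => (code M σ.toList : ℤ)) key ?_
        intro σ _ τ _ h
        exact Subtype.ext (code_injective hM (by simp [σ.2, τ.2]) (Int.natCast_inj.1 h))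
    _ ≤ 4 := by rw [Int.card_Icc]; omega

theorem eq_of_irrational_mem (hM : 0 < M) {σ τ : List (Fin M)} (hl : σ.length = τ.length) {x : ℝ}
    (hx : Irrational x) (hσ : x ∈ basicInterval M σ) (hτ : x ∈ basicInterval M τ) : σ = τ := by
  refine code_injective hM hl ?_
  have hMn : (0 : ℝ) < (M : ℝ) ^ τ.length := by positivity
  have hirr : Irrational (x * (M : ℝ) ^ τ.length) := by
    have := hx.mul_natCast (m := M ^ τ.length) (by positivity)
    simpa using this
  -- Irrationality excludes the right endpoint, so the code is recovered from the point as a floor.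
  have key : ∀ k : ℕ, x ∈ Icc ((k : ℝ) / M ^ τ.length) (((k : ℝ) + 1) / M ^ τ.length) →
      ⌊x * (M : ℝ) ^ τ.length⌋ = (k : ℤ) := by
    intro k hk
    rw [mem_Icc, div_le_iff₀ hMn, le_div_iff₀ hMn] at hk
    refine Int.floor_eq_iff.2 ⟨by simpa using hk.1, lt_of_le_of_ne (by simpa using hk.2) ?_⟩
    intro h
    exact hirr.ne_int (k + 1) (by rw [h]; push_cast; ring)
  rw [basicInterval_eq hM, hl] at hσ
  rw [basicInterval_eq hM] at hτ
  have := (key _ hσ).symm.trans (key _ hτ)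
  exact_mod_cast this

theorem limitSet_inter_subset (hM : 0 < M) {I I' : List (Fin M) → Set (Fin M)}
    (h : ∀ q : ℚ, (q : ℝ) ∉ limitSet I) :
    limitSet I ∩ limitSet I' ⊆ limitSet (fun σ => I σ ∩ I' σ) := by
  rintro x ⟨hx, hx'⟩
  have hirr : Irrational x := by
    rintro ⟨q, rfl⟩; exact h q hx
  refine mem_iInter.2 fun n => ?_
  obtain ⟨σ, hσ, hxσ⟩ := mem_iUnion₂.1 (mem_iInter.1 hx n)
  obtain ⟨τ, hτ, hxτ⟩ := mem_iUnion₂.1 (mem_iInter.1 hx' n)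
  obtain rfl := eq_of_irrational_mem hM
    ((length_of_mem_generation hσ).trans (length_of_mem_generation hτ).symm) hirr hxσ hxτ
  exact mem_iUnion₂.2 ⟨σ, by rw [generation_inter]; exact ⟨hσ, hτ⟩, hxσ⟩

/-! ### Independence and the law of the index sets. -/

variable {q : ℝ} {Ω : Type*} [MeasurableSpace Ω] {P : Measure Ω}
  {I : List (Fin M) → Ω → Set (Fin M)}

theorem measurableSet_mem_apply (σ : List (Fin M)) (j : Fin M) :
    MeasurableSet {T : List (Fin M) → Set (Fin M) | j ∈ T σ} :=
  ((measurable_set_mem j).comp (measurable_pi_apply σ)).setOf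

theorem IsFractalPercolation.measurable_mem (h : IsFractalPercolation P M q I)
    (σ : List (Fin M)) (j : Fin M) : Measurable fun ω => j ∈ I σ ω :=
  measurable_set_iff.1 (h.measurable σ) j

theorem IsFractalPercolation.measurableSet_mem (h : IsFractalPercolation P M q I)
    (σ : List (Fin M)) (j : Fin M) : MeasurableSet {ω | j ∈ I σ ω} :=
  (h.measurable_mem σ j).setOf

theorem IsFractalPercolation.measurable_pi (h : IsFractalPercolation P M q I) :
    Measurable fun ω σ => I σ ω :=
  measurable_pi_iff.2 h.measurable

theorem IsFractalPercolation.meas_biInter (h : IsFractalPercolation P M q I)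
    (s : Finset (List (Fin M) × Fin M)) :
    P (⋂ e ∈ s, {ω | e.2 ∈ I e.1 ω}) = ENNReal.ofReal q ^ s.card := by
  rw [iIndepSet.meas_biInter h.indep, Finset.prod_congr rfl fun e _ => h.prob_mem e.1 e.2,
    Finset.prod_const]

/-- Singletons give the one-edge probabilities, and then the formula for finite sets of edges is
independence. This makes intersections and pullbacks easy to recognise as percolations. -/
theorem isFractalPercolation_of_meas_biInter (hm : ∀ σ, Measurable (I σ))
    (h : ∀ s : Finset (List (Fin M) × Fin M),
      P (⋂ e ∈ s, {ω | e.2 ∈ I e.1 ω}) = ENNReal.ofReal q ^ s.card) :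
    IsFractalPercolation P M q I := by
  have h1 : ∀ σ j, P {ω | j ∈ I σ ω} = ENNReal.ofReal q := fun σ j => by
    simpa using h {(σ, j)}
  refine ⟨hm, h1, ?_⟩
  refine (iIndepSet_iff_meas_biInter
    (f := fun e : List (Fin M) × Fin M => {ω | e.2 ∈ I e.1 ω}) fun e => (measurable_set_iff.1 (hm e.1) e.2).setOf).2 ?_
  intro s
  rw [h, Finset.prod_congr rfl fun e _ => h1 e.1 e.2, Finset.prod_const]

theorem IsFractalPercolation.inter {p : ℝ} {I' : List (Fin M) → Ω → Set (Fin M)} (hp : 0 ≤ p)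
    (h : IsFractalPercolation P M p I) (h' : IsFractalPercolation P M q I')
    (hind : IndepFun (fun ω σ => I σ ω) (fun ω σ => I' σ ω) P) :
    IsFractalPercolation P M (p * q) (fun σ ω => I σ ω ∩ I' σ ω) := by
  refine isFractalPercolation_of_meas_biInter (fun σ => measurable_set_iff.2 fun j => ?_) fun s => ?_
  · exact measurableSet_setOfPred.1 ((h.measurableSet_mem σ j).inter (h'.measurableSet_mem σ j))
  · have hs : MeasurableSet {T : List (Fin M) → Set (Fin M) | ∀ e ∈ s, e.2 ∈ T e.1} := by
      simp only [ofPred_forall]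
      exact Finset.measurableSet_biInter s fun e _ => measurableSet_mem_apply e.1 e.2
    have := hind.measure_inter_preimage_eq_mul _ _ hs hs
    rw [ENNReal.ofReal_mul hp, mul_pow, ← h.meas_biInter, ← h'.meas_biInter]
    convert this using 2
    · ext ω; simp [forall_and]
    · congr 1; ext ω; simp
    · congr 1; ext ω; simp

theorem IsFractalPercolation.comp_measurePreserving {Ω' : Type*} [MeasurableSpace Ω']
    {P' : Measure Ω'} {g : Ω' → Ω} (h : IsFractalPercolation P M q I)
    (hg : MeasurePreserving g P' P) : IsFractalPercolation P' M q (fun σ ω => I σ (g ω)) := by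
  refine isFractalPercolation_of_meas_biInter (fun σ => (h.measurable σ).comp hg.measurable)
    fun s => ?_
  rw [← h.meas_biInter, ← hg.measure_preimage
    (Finset.measurableSet_biInter s fun e _ => h.measurableSet_mem e.1 e.2).nullMeasurableSet]
  simp only [preimage_iInter]
  rfl

theorem IsFractalPercolation.shift (h : IsFractalPercolation P M q I) (j : Fin M) :
    IsFractalPercolation P M q (fun σ => I (j :: σ)) := by
  refine ⟨fun σ => h.measurable _, fun σ => h.prob_mem _, ?_⟩
  refine h.indep.precomp (g := fun e : List (Fin M) × Fin M => (j :: e.1, e.2)) ?_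
  rintro ⟨σ, i⟩ ⟨τ, k⟩ h
  simpa using h

/-- The law of a `{0,1}`-valued (here `Prop`-valued) variable which holds with probability `q`. -/
noncomputable def bernoulliProp (q : ℝ) : Measure Prop :=
  ENNReal.ofReal q • Measure.dirac True + ENNReal.ofReal (1 - q) • Measure.dirac False

theorem bernoulliProp_true (q : ℝ) : bernoulliProp q {True} = ENNReal.ofReal q := by
  simp [bernoulliProp]

theorem isProbabilityMeasure_bernoulliProp (hq0 : 0 ≤ q) (hq1 : q ≤ 1) :
    IsProbabilityMeasure (bernoulliProp q) := by
  constructor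
  simp only [bernoulliProp, Measure.coe_add, Measure.coe_smul, Pi.add_apply, Pi.smul_apply,
    measure_univ, smul_eq_mul, mul_one]
  rw [← ENNReal.ofReal_add hq0 (by linarith)]
  simp

theorem measure_prop_ext {μ ν : Measure Prop} [IsProbabilityMeasure μ] [IsProbabilityMeasure ν]
    (h : μ {True} = ν {True}) : μ = ν := by
  refine Measure.ext_of_singleton fun a => ?_
  have hF : ({False} : Set Prop) = {True}ᶜ := by ext a; by_cases a <;> simp_all
  by_cases ha : a
  · simpa [ha] using h
  · simp only [ha, hF]
    rw [prob_compl_eq_one_sub (MeasurableSet.of_discrete), prob_compl_eq_one_sub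
      (MeasurableSet.of_discrete), h]

variable (M q) in
/-- The law of the index sets of a fractal percolation. -/
noncomputable def percolationLaw : Measure (List (Fin M) → Set (Fin M)) :=
  (Measure.infinitePi fun _ : List (Fin M) × Fin M => bernoulliProp q).map
    fun x σ => {j | x (σ, j)}

theorem measurable_ofEdges :
    Measurable fun (x : List (Fin M) × Fin M → Prop) (σ : List (Fin M)) => {j | x (σ, j)} :=
  measurable_pi_iff.2 fun σ => measurable_set_iff.2 fun j => measurable_pi_apply (σ, j)

theorem isProbabilityMeasure_percolationLaw (hq0 : 0 ≤ q) (hq1 : q ≤ 1) :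
    IsProbabilityMeasure (percolationLaw M q) := by
  have := isProbabilityMeasure_bernoulliProp hq0 hq1
  exact Measure.isProbabilityMeasure_map measurable_ofEdges.aemeasurable

theorem isFractalPercolation_percolationLaw (hq0 : 0 ≤ q) (hq1 : q ≤ 1) :
    IsFractalPercolation (percolationLaw M q) M q (fun σ T => T σ) := by
  have := isProbabilityMeasure_bernoulliProp hq0 hq1
  refine isFractalPercolation_of_meas_biInter measurable_pi_apply fun s => ?_
  rw [percolationLaw, Measure.map_apply measurable_ofEdges
    (Finset.measurableSet_biInter s fun e _ => measurableSet_mem_apply e.1 e.2)]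
  have : ((fun (x : List (Fin M) × Fin M → Prop) (σ : List (Fin M)) => {j | x (σ, j)}) ⁻¹'
      ⋂ e ∈ s, {T | e.2 ∈ T e.1}) = Set.pi s fun _ => {True} := by
    ext x; simp [Set.mem_pi]
  rw [this, Measure.infinitePi_pi _ (fun _ _ => MeasurableSet.of_discrete)]
  simp [bernoulliProp_true]

/-- The edge indicators are independent Bernoulli variables, so their joint law is the product
measure. Its use is that a subtree has the same law as the whole tree. -/
theorem IsFractalPercolation.map_eq [IsProbabilityMeasure P] (hq0 : 0 ≤ q) (hq1 : q ≤ 1)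
    (h : IsFractalPercolation P M q I) :
    P.map (fun ω σ => I σ ω) = percolationLaw M q := by
  have := isProbabilityMeasure_bernoulliProp hq0 hq1
  have hX : ∀ e : List (Fin M) × Fin M, Measurable fun ω => e.2 ∈ I e.1 ω :=
    fun e => h.measurable_mem e.1 e.2
  have hind : iIndepFun (fun (e : List (Fin M) × Fin M) ω => e.2 ∈ I e.1 ω) P :=
    h.indep.iIndep_comap_mem
  have hlaw : ∀ e : List (Fin M) × Fin M, P.map (fun ω => e.2 ∈ I e.1 ω) = bernoulliProp q := by
    intro e
    have := Measure.isProbabilityMeasure_map (μ := P) (hX e).aemeasurable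
    refine measure_prop_ext ?_
    rw [Measure.map_apply (hX e) MeasurableSet.of_discrete, bernoulliProp_true, ← h.prob_mem e.1 e.2]
    congr 1
    ext ω; simp
  have := hind.map_fun_eq_infinitePi_map hX
  simp only [hlaw] at this
  rw [percolationLaw, ← this, Measure.map_map measurable_ofEdges (measurable_pi_iff.2 hX)]
  rfl

theorem IsFractalPercolation.measure_shift_mem [IsProbabilityMeasure P] (hq0 : 0 ≤ q) (hq1 : q ≤ 1)
    (h : IsFractalPercolation P M q I) (j : Fin M) {A : Set (List (Fin M) → Set (Fin M))}
    (hA : MeasurableSet A) :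
    P {ω | (fun σ => I (j :: σ) ω) ∈ A} = P {ω | (fun σ => I σ ω) ∈ A} := by
  have h1 := (h.shift j).map_eq hq0 hq1
  rw [← h.map_eq hq0 hq1] at h1
  have h2 := congrArg (· A) h1
  simp only [Measure.map_apply (h.shift j).measurable_pi hA,
    Measure.map_apply h.measurable_pi hA] at h2
  exact h2

/-! ### The branching property. -/

/-- Events measurable with respect to disjoint blocks of independent `σ`-algebras satisfy the
product formula. -/
theorem iIndep_meas_biInter_blocks {ι κ : Type*} {m : ι → MeasurableSpace Ω} (hm : ∀ i, m i ≤ ‹_›)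
    (h : iIndep m P) {S : κ → Set ι} (hS : Pairwise (Function.onFun Disjoint S)) {B : κ → Set Ω}
    (hB : ∀ k, MeasurableSet[⨆ i ∈ S k, m i] (B k)) (t : Finset κ) :
    P (⋂ k ∈ t, B k) = ∏ k ∈ t, P (B k) := by
  classical
  have := h.isProbabilityMeasure
  induction t using Finset.induction with
  | empty => simp
  | insert a t ha ih =>
    have hdisj : Disjoint (S a) (⋃ k ∈ t, S k) := by
      rw [disjoint_iUnion₂_right]
      exact fun k hk => hS (by rintro rfl; exact ha hk)
    have hind := indep_iSup_of_disjoint hm h hdisj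
    have hmeas : MeasurableSet[⨆ i ∈ ⋃ k ∈ t, S k, m i] (⋂ k ∈ t, B k) := by
      refine @Finset.measurableSet_biInter _ _ (⨆ i ∈ ⋃ k ∈ t, S k, m i) _ t fun k hk => ?_
      exact (biSup_mono fun i hi => mem_biUnion (t := S) hk hi : (⨆ i ∈ S k, m i) ≤ _) _ (hB k)
    rw [Finset.set_biInter_insert, Finset.prod_insert ha, ← ih]
    exact (Indep_iff _ _ _).1 hind _ _ (hB a) hmeas

/-- The edges of the subtree at `j`, together with the edge that leads to it. -/
def branch (j : Fin M) : Set (List (Fin M) × Fin M) := {e | e = ([], j) ∨ ∃ σ, e.1 = j :: σ}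

theorem pairwise_disjoint_branch : Pairwise (Function.onFun Disjoint (branch (M := M))) := by
  intro i j hij
  refine Set.disjoint_left.2 ?_
  rintro ⟨σ, k⟩ (h | ⟨τ, h⟩) (h' | ⟨τ', h'⟩) <;> simp_all

theorem measurableSet_mem_iSup {X : Type*} {I : List (Fin M) → X → Set (Fin M)}
    {S : Set (List (Fin M) × Fin M)} {σ : List (Fin M)} {j : Fin M} (hS : (σ, j) ∈ S) :
    MeasurableSet[⨆ e ∈ S, MeasurableSpace.comap (fun ω => e.2 ∈ I e.1 ω) ⊤] {ω | j ∈ I σ ω} :=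
  (le_iSup₂_of_le (f := fun (e : List (Fin M) × Fin M) (_ : e ∈ S) =>
    MeasurableSpace.comap (fun ω => e.2 ∈ I e.1 ω) ⊤) (σ, j) hS le_rfl) _
    ⟨{True}, trivial, by ext; simp⟩

theorem measurable_shift_iSup {X : Type*} {I : List (Fin M) → X → Set (Fin M)} (j : Fin M)
    {S : Set (List (Fin M) × Fin M)}
    (hS : ∀ σ i, (j :: σ, i) ∈ S) :
    Measurable[⨆ e ∈ S, MeasurableSpace.comap (fun ω => e.2 ∈ I e.1 ω) ⊤]
      (fun ω σ => I (j :: σ) ω) := by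
  refine @measurable_pi_iff _ _ _ (_) _ _ |>.2 fun σ => ?_
  exact @measurable_set_iff _ _ (_) _ |>.2 fun i =>
    (@measurableSet_setOfPred _ (_) _).1 (measurableSet_mem_iSup (hS σ i))

/-- The root edge to `j` is independent of all edges that start at nonempty words, and the subtree
at `j` has the law of the whole tree. -/
theorem IsFractalPercolation.measure_mem_root_and_shift [IsProbabilityMeasure P]
    (hq0 : 0 ≤ q) (hq1 : q ≤ 1) (h : IsFractalPercolation P M q I) (j : Fin M)
    {A : Set (List (Fin M) → Set (Fin M))} (hA : MeasurableSet A) :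
    P {ω | j ∈ I [] ω ∧ (fun σ => I (j :: σ) ω) ∈ A} =
      ENNReal.ofReal q * P {ω | (fun σ => I σ ω) ∈ A} := by
  rw [← h.measure_shift_mem hq0 hq1 j hA, ← h.prob_mem [] j]
  have hle : ∀ e : List (Fin M) × Fin M,
      MeasurableSpace.comap (fun ω => e.2 ∈ I e.1 ω) ⊤ ≤ ‹MeasurableSpace Ω› :=
    fun e => (h.measurable_mem e.1 e.2).comap_le
  have hdisj : Disjoint {(([] : List (Fin M)), j)} {e : List (Fin M) × Fin M | e.1 ≠ []} := by
    simp
  have hind := indep_iSup_of_disjoint hle h.indep.iIndep_comap_mem hdisj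
  refine (Indep_iff _ _ _).1 hind {ω | j ∈ I [] ω} {ω | (fun σ => I (j :: σ) ω) ∈ A} ?_ ?_
  · exact measurableSet_mem_iSup (by simp)
  · exact measurable_shift_iSup j (by simp) hA

/-- The branching property. -/
theorem IsFractalPercolation.real_forall_mem_root [IsProbabilityMeasure P]
    (hq0 : 0 ≤ q) (hq1 : q ≤ 1) (h : IsFractalPercolation P M q I)
    {A : Set (List (Fin M) → Set (Fin M))} (hA : MeasurableSet A) :
    P.real {ω | ∀ j ∈ I [] ω, (fun σ => I (j :: σ) ω) ∈ A} =
      (1 - q + q * P.real {ω | (fun σ => I σ ω) ∈ A}) ^ M := by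
  have hle : ∀ e : List (Fin M) × Fin M,
      MeasurableSpace.comap (fun ω => e.2 ∈ I e.1 ω) ⊤ ≤ ‹MeasurableSpace Ω› :=
    fun e => (h.measurable_mem e.1 e.2).comap_le
  -- The event "`j` is present and its subtree is bad" depends only on the edges in `branch j`;
  -- these blocks are disjoint, so the complementary events multiply.
  have hmeas : ∀ j : Fin M, MeasurableSet[⨆ e ∈ branch j,
      MeasurableSpace.comap (fun ω => e.2 ∈ I e.1 ω) ⊤]
      {ω | j ∈ I [] ω ∧ (fun σ => I (j :: σ) ω) ∈ Aᶜ} := by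
    intro j
    refine @MeasurableSet.inter _ (_) {ω | j ∈ I [] ω} {ω | (fun σ => I (j :: σ) ω) ∈ Aᶜ} ?_ ?_
    · exact measurableSet_mem_iSup (Or.inl rfl)
    · exact measurable_shift_iSup j (fun σ i => Or.inr ⟨σ, rfl⟩) hA.compl
  have hprod := iIndep_meas_biInter_blocks hle h.indep.iIndep_comap_mem pairwise_disjoint_branch
    (fun j => @MeasurableSet.compl _ _ (_) (hmeas j)) Finset.univ
  have hset : {ω | ∀ j ∈ I [] ω, (fun σ => I (j :: σ) ω) ∈ A} = ⋂ j ∈ (Finset.univ : Finset (Fin M)),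
      {ω | j ∈ I [] ω ∧ (fun σ => I (j :: σ) ω) ∈ Aᶜ}ᶜ := by
    ext ω; simp
  have hA' : MeasurableSet {ω | (fun σ => I σ ω) ∈ A} := h.measurable_pi hA
  have hone : ∀ j, P.real {ω | j ∈ I [] ω ∧ (fun σ => I (j :: σ) ω) ∈ Aᶜ}ᶜ =
      1 - q + q * P.real {ω | (fun σ => I σ ω) ∈ A} := by
    intro j
    rw [probReal_compl_eq_one_sub ((iSup₂_le fun e _ => hle e) _ (hmeas j)), measureReal_def,
      h.measure_mem_root_and_shift hq0 hq1 j hA.compl, ENNReal.toReal_mul, ENNReal.toReal_ofReal hq0,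
      ← measureReal_def, show {ω | (fun σ => I σ ω) ∈ Aᶜ} = {ω | (fun σ => I σ ω) ∈ A}ᶜ from rfl,
      probReal_compl_eq_one_sub hA']
    ring
  rw [hset, measureReal_def, hprod, ENNReal.toReal_prod]
  simp only [← measureReal_def, hone, Finset.prod_const, Finset.card_univ, Fintype.card_fin]

/-! ### Measurability and probability of generation events. -/

theorem measurableSet_mem_generation (σ : List (Fin M)) (n : ℕ) :
    MeasurableSet {T : List (Fin M) → Set (Fin M) | σ ∈ generation T n} := by
  induction n generalizing σ with
  | zero => simp [generation]
  | succ n ih =>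
    have : {T : List (Fin M) → Set (Fin M) | σ ∈ generation T (n + 1)} =
        ⋃ τ : List (Fin M), ⋃ i : Fin M, ⋃ _ : σ = τ ++ [i],
          {T | τ ∈ generation T n} ∩ {T | i ∈ T τ} := by
      ext T
      simp only [generation, mem_ofPred_eq, mem_iUnion, mem_inter_iff, exists_prop]
      grind
    rw [this]
    exact MeasurableSet.iUnion fun τ => MeasurableSet.iUnion fun i => MeasurableSet.iUnion fun _ =>
      (ih τ).inter (measurableSet_mem_apply τ i)

theorem measurableSet_generation_nonempty (n : ℕ) :
    MeasurableSet {T : List (Fin M) → Set (Fin M) | (generation T n).Nonempty} := by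
  simp only [Set.Nonempty, ofPred_exists]
  exact MeasurableSet.iUnion fun σ => measurableSet_mem_generation σ n

theorem measurableSet_survives : MeasurableSet {T : List (Fin M) → Set (Fin M) | Survives T} := by
  simp only [Survives, ofPred_forall]
  exact MeasurableSet.iInter measurableSet_generation_nonempty

theorem IsFractalPercolation.measure_mem_generation [IsProbabilityMeasure P]
    (hq0 : 0 ≤ q) (hq1 : q ≤ 1) (h : IsFractalPercolation P M q I) (σ : List (Fin M)) :
    P {ω | σ ∈ generation (fun τ => I τ ω) σ.length} = ENNReal.ofReal q ^ σ.length := by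
  induction σ with
  | nil => simp [generation]
  | cons j σ ih =>
    rw [List.length_cons, pow_succ', ← ih]
    simp only [cons_mem_generation_succ]
    exact h.measure_mem_root_and_shift hq0 hq1 j (measurableSet_mem_generation σ σ.length)

/-! ### Fixed points of the generating function. -/

/-- Since 1 is also a fixed point, e < g < 1 would put three points of the graph of a strictly
convex function on the diagonal. -/
theorem fixedPoint_unique {M : ℕ} (hM : 2 ≤ M) {q e g : ℝ} (hq0 : 0 < q) (hq1 : q ≤ 1)
    (he0 : 0 ≤ e) (heg : e ≤ g) (hg1 : g < 1) (he : e = (1 - q + q * e) ^ M)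
    (hg : g = (1 - q + q * g) ^ M) : e = g := by
  by_contra hne
  have hlt : e < g := lt_of_le_of_ne heg hne
  have h1e : 0 < 1 - e := by linarith
  have ha : 0 < (1 - g) / (1 - e) := div_pos (by linarith) h1e
  have hb : 0 < (g - e) / (1 - e) := div_pos (by linarith) h1e
  have hab : (1 - g) / (1 - e) + (g - e) / (1 - e) = 1 := by field_simp; ring
  have hconv := (strictConvexOn_pow hM).2 (x := 1 - q + q * e) (y := 1)
    (mem_Ici.2 (by nlinarith)) (mem_Ici.2 zero_le_one) (by nlinarith) ha hb hab
  have hcomb : (1 - g) / (1 - e) * (1 - q + q * e) + (g - e) / (1 - e) * 1 = 1 - q + q * g := by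
    field_simp; ring
  have hcomb' : (1 - g) / (1 - e) * e + (g - e) / (1 - e) * 1 = g := by
    field_simp; ring
  simp only [smul_eq_mul, one_pow] at hconv
  rw [hcomb, ← he, ← hg, hcomb'] at hconv
  exact lt_irrefl _ hconv

theorem eq_one_of_fixedPoint {M : ℕ} (hM : 2 ≤ M) {q e : ℝ} (hq0 : 0 ≤ q) (hq1 : q ≤ 1)
    (hMq : M * q ≤ 1) (he0 : 0 ≤ e) (he1 : e ≤ 1) (he : e = (1 - q + q * e) ^ M) : e = 1 := by
  by_contra hne
  have hlt : e < 1 := lt_of_le_of_ne he1 hne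
  rcases hq0.eq_or_lt with rfl | hq
  · simp at he; exact hne he
  set y := q * (1 - e) with hy
  have hypos : 0 < y := mul_pos hq (by linarith)
  have hy1 : y ≤ 1 := by nlinarith
  -- Bernoulli's inequality is applied to only `M - 1` factors: the remaining factor leaves a term k
  -- y² > 0, which makes the inequality strict even in the critical case Mq = 1.
  obtain ⟨k, rfl⟩ : ∃ k, M = k + 1 := ⟨M - 1, by omega⟩
  have hk : (1 : ℝ) ≤ k := by exact_mod_cast (by omega : 1 ≤ k)
  have hb := one_add_mul_le_pow (a := -y) (by linarith) k
  have hbase : 1 - q + q * e = 1 + -y := by rw [hy]; ring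
  rw [hbase, pow_succ] at he
  have h2 : (1 + (k : ℝ) * -y) * (1 + -y) ≤ (1 + -y) ^ k * (1 + -y) :=
    mul_le_mul_of_nonneg_right hb (by linarith)
  have h3 : ((k : ℝ) + 1) * y ≤ 1 - e := by
    rw [hy, ← mul_assoc]
    push_cast at hMq
    nlinarith
  have h4 : 0 < (k : ℝ) * y * y := by positivity
  nlinarith

/-- Makes (Mq)⁻¹ < 1 a barrier for the iteration of f. With y = q - 1/M one has Mq = 1 + My ≤ (1 +
y)^M, and (1 - y)^M (1 + y)^M ≤ 1. -/
theorem pow_le_inv_of_supercritical {M : ℕ} {q : ℝ} (hq1 : q ≤ 1) (hq0 : 0 < q)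
    (hMq : 1 < M * q) : (1 - q + q * (M * q)⁻¹) ^ M ≤ (M * q)⁻¹ := by
  have hinv : (M * q)⁻¹ < 1 := inv_lt_one_of_one_lt₀ hMq
  set y := q * (1 - (M * q)⁻¹) with hy
  have hy0 : 0 < y := mul_pos hq0 (by linarith)
  have hinv0 : 0 < (M * q)⁻¹ := by positivity
  have hy1 : y ≤ 1 := by nlinarith
  have hbase : 1 - q + q * (M * q)⁻¹ = 1 - y := by rw [hy]; ring
  have hMy : 1 + M * y = M * q := by
    rw [hy, ← mul_assoc, mul_sub, mul_inv_cancel₀ (by linarith)]; ring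
  have hb := one_add_mul_le_pow (a := y) (by linarith) M
  rw [hMy] at hb
  rw [hbase, ← one_div, le_div_iff₀ (by linarith)]
  calc (1 - y) ^ M * (M * q) ≤ (1 - y) ^ M * (1 + y) ^ M :=
        mul_le_mul_of_nonneg_left hb (pow_nonneg (by linarith) _)
    _ = (1 - y ^ 2) ^ M := by rw [← mul_pow]; ring
    _ ≤ 1 := pow_le_one₀ (by nlinarith) (by nlinarith)

/-! ### Extinction and survival. -/

variable [IsProbabilityMeasure P]

/-- Needed for two properties: extinction of the tree, and almost sure extinction of its thinning.
-/
theorem IsFractalPercolation.fixedPoint_of_inherited (hq0 : 0 ≤ q) (hq1 : q ≤ 1)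
    (h : IsFractalPercolation P M q I) {A : Set (List (Fin M) → Set (Fin M))}
    (hA : MeasurableSet A) (hinh : ∀ T, T ∈ A ↔ ∀ j ∈ T [], subtreeAt T j ∈ A) :
    P.real {ω | (fun σ => I σ ω) ∈ A} = (1 - q + q * P.real {ω | (fun σ => I σ ω) ∈ A}) ^ M := by
  rw [← h.real_forall_mem_root hq0 hq1 hA]
  congr 1
  ext ω
  exact hinh _

theorem not_survives_iff {T : List (Fin M) → Set (Fin M)} :
    ¬ Survives T ↔ ∀ j ∈ T [], ¬ Survives (subtreeAt T j) := by
  rw [survives_iff]; push Not; rfl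

theorem IsFractalPercolation.ae_not_survives (hM : 2 ≤ M) (hq0 : 0 ≤ q) (hq1 : q ≤ 1)
    (h : IsFractalPercolation P M q I) (hMq : M * q ≤ 1) :
    ∀ᵐ ω ∂P, ¬ Survives (fun σ => I σ ω) := by
  have hfix := h.fixedPoint_of_inherited hq0 hq1 (A := {T | ¬ Survives T})
    measurableSet_survives.compl fun T => not_survives_iff
  have := eq_one_of_fixedPoint hM hq0 hq1 hMq measureReal_nonneg measureReal_le_one hfix
  rw [measureReal_def, ENNReal.toReal_eq_one_iff] at this
  exact (mem_ae_iff_prob_eq_one (h.measurable_pi measurableSet_survives.compl)).2 this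

/-- The probability of extinction by level n starts at 0 and is iterated by the increasing map f, so
it never passes the barrier (Mq)⁻¹; continuity from below gives the same bound for extinction. -/
theorem IsFractalPercolation.measure_survives_pos (hq0 : 0 < q) (hq1 : q ≤ 1)
    (h : IsFractalPercolation P M q I) (hMq : 1 < M * q) :
    0 < P {ω | Survives (fun σ => I σ ω)} := by
  have hbound : ∀ n, P.real {ω | ¬ (generation (fun σ => I σ ω) n).Nonempty} ≤ (M * q)⁻¹ := by
    intro n
    induction n with
    | zero =>
      have : 0 ≤ ((M : ℝ) * q)⁻¹ := by positivity
      simpa [generation] using this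
    | succ n ih =>
      have := h.real_forall_mem_root hq0.le hq1 (measurableSet_generation_nonempty n).compl
      have hset : {ω | ¬ (generation (fun σ => I σ ω) (n + 1)).Nonempty} =
          {ω | ∀ j ∈ I [] ω, (fun σ => I (j :: σ) ω) ∈
            {T : List (Fin M) → Set (Fin M) | (generation T n).Nonempty}ᶜ} := by
        ext ω
        simp only [mem_ofPred_eq, generation_succ_nonempty]
        simp only [not_exists, not_and]
        rfl
      rw [hset, this]
      replace ih : P.real {ω | (fun σ => I σ ω) ∈
          {T : List (Fin M) → Set (Fin M) | (generation T n).Nonempty}ᶜ} ≤ (M * q)⁻¹ := ih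
      refine le_trans ?_ (pow_le_inv_of_supercritical hq1 hq0 hMq)
      gcongr
  have hmono : Monotone fun n => {ω | ¬ (generation (fun σ => I σ ω) n).Nonempty} :=
    fun m n hmn ω hω hne => hω (generation_nonempty_antitone hmn hne)
  have hunion : {ω | Survives (fun σ => I σ ω)}ᶜ =
      ⋃ n, {ω | ¬ (generation (fun σ => I σ ω) n).Nonempty} := by
    ext ω; simp [Survives]
  have hle : P {ω | Survives (fun σ => I σ ω)}ᶜ ≤ ENNReal.ofReal (M * q)⁻¹ := by
    rw [hunion, hmono.measure_iUnion]
    refine iSup_le fun n => ?_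
    rw [← ofReal_measureReal]
    exact ENNReal.ofReal_le_ofReal (hbound n)
  rw [pos_iff_ne_zero]
  intro h0
  have hS : MeasurableSet {ω | Survives (fun σ => I σ ω)} := h.measurable_pi measurableSet_survives
  rw [prob_compl_eq_one_sub hS, h0, tsub_zero,
    ENNReal.one_le_ofReal] at hle
  exact absurd hle (not_le.2 (inv_lt_one_of_one_lt₀ hMq))

/-! ### Hitting probabilities and Hausdorff measure. -/

open Filter Topology
open scoped NNReal ENNReal

/-- Union bound: at most four intervals of level n meet the set, and each is retained with
probability qⁿ. -/
theorem IsFractalPercolation.measure_hit_le (hM : 0 < M) (hq0 : 0 ≤ q) (hq1 : q ≤ 1)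
    (h : IsFractalPercolation P M q I) {U : Set ℝ} {u : ℝ} {n : ℕ}
    (hU : ∀ x ∈ U, |x - u| ≤ ((M : ℝ) ^ n)⁻¹) :
    P {ω | (limitSet (fun σ => I σ ω) ∩ U).Nonempty} ≤ 4 * ENNReal.ofReal q ^ n := by
  classical
  set s : Finset (List.Vector (Fin M) n) :=
    Finset.univ.filter fun σ => (basicInterval M σ.toList ∩ U).Nonempty with hs
  have hcard : s.card ≤ 4 := by
    refine card_hit_le hM (u := u) s fun σ hσ => ?_
    obtain ⟨x, hx, hxU⟩ := (Finset.mem_filter.1 hσ).2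
    exact ⟨x, hx, hU x hxU⟩
  calc P {ω | (limitSet (fun σ => I σ ω) ∩ U).Nonempty}
      ≤ P (⋃ σ ∈ s, {ω | σ.toList ∈ generation (fun τ => I τ ω) n}) := by
        refine measure_mono ?_
        rintro ω ⟨x, hx, hxU⟩
        obtain ⟨σ, hσ, hxσ⟩ := mem_iUnion₂.1 (mem_iInter.1 hx n)
        refine mem_iUnion₂.2 ⟨⟨σ, length_of_mem_generation hσ⟩, ?_, hσ⟩
        exact Finset.mem_filter.2 ⟨Finset.mem_univ _, x, hxσ, hxU⟩
    _ ≤ ∑ σ ∈ s, P {ω | σ.toList ∈ generation (fun τ => I τ ω) n} :=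
        measure_biUnion_finset_le _ _
    _ = ∑ σ ∈ s, ENNReal.ofReal q ^ n := by
        refine Finset.sum_congr rfl fun σ _ => ?_
        have := h.measure_mem_generation hq0 hq1 σ.toList
        rwa [List.Vector.toList_length] at this
    _ ≤ 4 * ENNReal.ofReal q ^ n := by
        rw [Finset.sum_const, nsmul_eq_mul]
        gcongr
        exact_mod_cast hcard

theorem IsFractalPercolation.measure_hit_singleton (hM : 0 < M) (hq0 : 0 ≤ q) (hq1 : q < 1)
    (h : IsFractalPercolation P M q I) (u : ℝ) :
    P {ω | u ∈ limitSet (fun σ => I σ ω)} = 0 := by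
  have hle : ∀ n : ℕ, P {ω | u ∈ limitSet (fun σ => I σ ω)} ≤ 4 * ENNReal.ofReal q ^ n := by
    intro n
    have := h.measure_hit_le hM hq0 hq1.le (U := {u}) (u := u) (n := n) (by
      rintro x rfl; simp)
    simpa using this
  have hlim : Tendsto (fun n : ℕ => 4 * ENNReal.ofReal q ^ n) atTop (𝓝 0) := by
    have := ENNReal.Tendsto.const_mul (a := 4) (ENNReal.tendsto_pow_atTop_nhds_zero_of_lt_one
      (ENNReal.ofReal_lt_one.2 hq1)) (Or.inr (by simp))
    simpa using this
  exact le_antisymm (ge_of_tendsto' hlim hle) zero_le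

/-- The probability that a fractal percolation with `q = M⁻ˢ` hits a set is at most a constant
multiple of the `s`-th power of the diameter. -/
theorem IsFractalPercolation.measure_hit_le_ediam_rpow (hM : 2 ≤ M) {s : ℝ} (hs : 0 < s)
    (hq : q = (M : ℝ) ^ (-s)) (h : IsFractalPercolation P M q I) {U : Set ℝ}
    (hU : Metric.ediam U ≤ 1) :
    P {ω | (limitSet (fun σ => I σ ω) ∩ U).Nonempty} ≤
      (4 * ENNReal.ofReal ((M : ℝ) ^ s)) * Metric.ediam U ^ s := by
  have hM1 : (1 : ℝ) < M := by exact_mod_cast hM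
  have hM0 : (0 : ℝ) < M := by linarith
  have hq0 : 0 ≤ q := by rw [hq]; positivity
  have hq1 : q < 1 := by rw [hq]; exact Real.rpow_lt_one_of_one_lt_of_neg hM1 (by linarith)
  rcases U.eq_empty_or_nonempty with rfl | ⟨u, hu⟩
  · simp
  set d := (Metric.ediam U).toReal with hd
  have htop : Metric.ediam U ≠ ∞ := ne_top_of_le_ne_top ENNReal.one_ne_top hU
  have hd' : Metric.ediam U = ENNReal.ofReal d := (ENNReal.ofReal_toReal htop).symm
  have hd1 : d ≤ 1 := by
    rw [hd]; exact ENNReal.toReal_le_of_le_ofReal zero_le_one (by simpa using hU)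
  have hxu : ∀ x ∈ U, |x - u| ≤ d := by
    intro x hx
    have := Metric.edist_le_ediam_of_mem hx hu
    rw [edist_dist, hd', ENNReal.ofReal_le_ofReal_iff ENNReal.toReal_nonneg, Real.dist_eq] at this
    exact this
  -- Diameter 0 has no matching scale; there the set is a single point, which is hit with
  -- probability 0.
  rcases (show 0 ≤ d from ENNReal.toReal_nonneg).eq_or_lt with hd0 | hd0
  · have : U ⊆ {u} := fun x hx => by
      have := hxu x hx
      rw [← hd0] at this
      exact sub_eq_zero.1 (abs_nonpos_iff.1 this)
    refine le_trans (measure_mono ?_ : _ ≤ P {ω | u ∈ limitSet (fun σ => I σ ω)}) ?_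
    · rintro ω ⟨x, hx, hxU⟩
      rw [this hxU] at hx
      exact hx
    · rw [h.measure_hit_singleton (by omega) hq0 hq1]; exact zero_le
  -- The scale with M⁻⁽ⁿ⁺¹⁾ < d ≤ M⁻ⁿ; the gap of one level costs the factor Mˢ.
  · obtain ⟨n, hn1, hn2⟩ := exists_nat_pow_near_of_lt_one hd0 hd1 (inv_pos.2 hM0)
      (inv_lt_one_of_one_lt₀ hM1)
    refine (h.measure_hit_le (by omega) hq0 hq1.le (u := u) (n := n) fun x hx => ?_).trans ?_
    · rw [← inv_pow]; exact (hxu x hx).trans hn2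
    · rw [mul_assoc]
      gcongr
      rw [hd', ENNReal.ofReal_rpow_of_pos hd0, ← ENNReal.ofReal_mul (by positivity),
        ← ENNReal.ofReal_pow hq0]
      refine ENNReal.ofReal_le_ofReal ?_
      have hqi : q = (M : ℝ)⁻¹ ^ s := by rw [hq, Real.rpow_neg hM0.le, Real.inv_rpow hM0.le]
      calc q ^ n = (M : ℝ) ^ s * ((M : ℝ)⁻¹ ^ (n + 1)) ^ s := by
            rw [hqi, ← Real.mul_rpow hM0.le (by positivity), ← Real.rpow_mul_natCast (by positivity),
              mul_comm s, Real.rpow_natCast_mul (by positivity)]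
            congr 1
            rw [pow_succ]; field_simp
        _ ≤ (M : ℝ) ^ s * d ^ s := by gcongr

/-- A set of zero `s`-dimensional Hausdorff measure is not hit by a fractal percolation with
parameter `M⁻ˢ`. -/
theorem IsFractalPercolation.measure_hit_eq_zero (hM : 2 ≤ M) {s : ℝ} (hs : 0 < s)
    (hq : q = (M : ℝ) ^ (-s)) (h : IsFractalPercolation P M q I) {U : Set ℝ}
    (hU : μH[s] U = 0) : P {ω | (limitSet (fun σ => I σ ω) ∩ U).Nonempty} = 0 := by
  -- The hitting probability is countably subadditive in the set, hence an outer measure, and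
  -- `mkMetric` is maximal among outer measures with the given bound on sets of small diameter.
  let c : OuterMeasure ℝ :=
    { measureOf := fun U => P {ω | (limitSet (fun σ => I σ ω) ∩ U).Nonempty}
      empty := by simp
      mono := fun {U V} hUV => measure_mono fun ω hω => hω.mono (inter_subset_inter_right _ hUV)
      iUnion_nat := fun V _ => by
        refine le_trans (measure_mono ?_) (measure_iUnion_le _)
        rintro ω ⟨x, hx, hxV⟩
        obtain ⟨i, hi⟩ := mem_iUnion.1 hxV
        exact mem_iUnion.2 ⟨i, x, hx, hi⟩ }
  set C : ℝ≥0∞ := 4 * ENNReal.ofReal ((M : ℝ) ^ s) with hC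
  have hM0 : (0 : ℝ) < M := by exact_mod_cast (by omega : 0 < M)
  have hC0 : C ≠ 0 := by
    rw [hC]
    exact mul_ne_zero (by norm_num) (ENNReal.ofReal_pos.2 (Real.rpow_pos_of_pos hM0 s)).ne'
  have hCtop : C ≠ ∞ := ENNReal.mul_ne_top (by norm_num) ENNReal.ofReal_ne_top
  have h1 : c ≤ OuterMeasure.mkMetric (fun d => C * d ^ s) :=
    OuterMeasure.le_mkMetric _ c 1 one_pos fun V hV => h.measure_hit_le_ediam_rpow hM hs hq hV
  have h2 : (OuterMeasure.mkMetric (fun d => C * d ^ s) : OuterMeasure ℝ) ≤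
      C • OuterMeasure.mkMetric (fun d => d ^ s) :=
    OuterMeasure.mkMetric_mono_smul hCtop hC0 (Eventually.of_forall fun d => le_rfl)
  have h3 : c U ≤ C * μH[s] U := by
    refine ((h1.trans h2) U).trans ?_
    rw [Measure.hausdorffMeasure, ← OuterMeasure.coe_mkMetric]
    rfl
  rw [hU, mul_zero] at h3
  exact le_antisymm h3 zero_le

/-! ### Lower bound: thinning by an independent percolation. -/

/-- The probability that the tree `T`, thinned by an independent percolation, is infinite. -/
noncomputable def thinnedSurvival (r : ℝ) (T : List (Fin M) → Set (Fin M)) : ℝ≥0∞ :=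
  percolationLaw M r {T' | Survives fun σ => T σ ∩ T' σ}

theorem measurable_inter_trees :
    Measurable fun (x : (List (Fin M) → Set (Fin M)) × (List (Fin M) → Set (Fin M))) σ =>
      x.1 σ ∩ x.2 σ := by
  refine measurable_pi_iff.2 fun σ => measurable_set_iff.2 fun j => measurableSet_setOfPred.1 ?_
  exact (measurable_fst (measurableSet_mem_apply σ j)).inter
    (measurable_snd (measurableSet_mem_apply σ j))

theorem measurable_thinnedSurvival {r : ℝ} (hr0 : 0 ≤ r) (hr1 : r ≤ 1) :
    Measurable (thinnedSurvival (M := M) r) := by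
  have := isProbabilityMeasure_percolationLaw (M := M) hr0 hr1
  exact measurable_measure_prodMk_left (ν := percolationLaw M r)
    (measurable_inter_trees measurableSet_survives)

/-- Survival of the thinned tree is a finite union over the children `j`, with probabilities r times
the thinned survival of the subtree at `j`; since r > 0, the union is null iff each of these
vanishes. -/
theorem thinnedSurvival_eq_zero_iff {r : ℝ} (hr0 : 0 < r) (hr1 : r ≤ 1)
    (T : List (Fin M) → Set (Fin M)) :
    thinnedSurvival r T = 0 ↔ ∀ j ∈ T [], thinnedSurvival r (subtreeAt T j) = 0 := by
  have := isProbabilityMeasure_percolationLaw (M := M) hr0.le hr1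
  have hset : {T' : List (Fin M) → Set (Fin M) | Survives fun σ => T σ ∩ T' σ} =
      ⋃ j ∈ T [], {T' | j ∈ T' [] ∧ (fun σ => T' (j :: σ)) ∈
        {T'' | Survives fun σ => subtreeAt T j σ ∩ T'' σ}} := by
    ext T'
    rw [mem_ofPred_eq, survives_iff]
    simp only [mem_iUnion, mem_inter_iff, and_assoc, exists_prop]
    rfl
  rw [thinnedSurvival, hset, measure_biUnion_null_iff (toFinite _).countable]
  refine forall₂_congr fun j _ => ?_
  have hmeas : MeasurableSet {T'' : List (Fin M) → Set (Fin M) | Survives fun σ => subtreeAt T j σ ∩ T'' σ} :=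
    (measurable_inter_trees.comp measurable_prodMk_left) measurableSet_survives
  rw [(isFractalPercolation_percolationLaw hr0.le hr1).measure_mem_root_and_shift hr0.le hr1 j hmeas]
  simp [thinnedSurvival, hr0]

/-- Whenever the thinned tree survives, its limit set provides a point at which the test percolation
hits `limitSet T`; a set of measure zero would almost surely be missed. -/
theorem hausdorffMeasure_limitSet_ne_zero (hM : 2 ≤ M) {s : ℝ} (hs : 0 < s)
    {T : List (Fin M) → Set (Fin M)} (hT : thinnedSurvival ((M : ℝ) ^ (-s)) T ≠ 0) :
    μH[s] (limitSet T) ≠ 0 := by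
  intro h0
  have hM1 : (1 : ℝ) < M := by exact_mod_cast hM
  have hr0 : (0 : ℝ) ≤ (M : ℝ) ^ (-s) := by positivity
  have hr1 : (M : ℝ) ^ (-s) ≤ 1 := (Real.rpow_lt_one_of_one_lt_of_neg hM1 (by linarith)).le
  have := isProbabilityMeasure_percolationLaw (M := M) hr0 hr1
  refine hT (measure_mono_null ?_
    ((isFractalPercolation_percolationLaw hr0 hr1).measure_hit_eq_zero hM hs rfl h0))
  intro T' hT'
  obtain ⟨x, hx⟩ := (limitSet_nonempty_iff (by omega) _).2 hT'
  exact ⟨x, limitSet_mono (fun _ => inter_subset_right) hx,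
    limitSet_mono (fun _ => inter_subset_left) hx⟩

theorem IsFractalPercolation.ae_hausdorffMeasure_ne_zero (hM : 2 ≤ M) (hq0 : 0 < q) (hq1 : q ≤ 1)
    (h : IsFractalPercolation P M q I) {s : ℝ} (hs : 0 < s) (hsq : (M : ℝ) ^ s < M * q) :
    ∀ᵐ ω ∂P, Survives (fun σ => I σ ω) → μH[s] (limitSet fun σ => I σ ω) ≠ 0 := by
  have hM1 : (1 : ℝ) < M := by exact_mod_cast hM
  have hM0 : (0 : ℝ) < M := by linarith
  set r : ℝ := (M : ℝ) ^ (-s) with hr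
  have hr0 : 0 < r := Real.rpow_pos_of_pos hM0 _
  have hr1 : r ≤ 1 := (Real.rpow_lt_one_of_one_lt_of_neg hM1 (by linarith)).le
  have := isProbabilityMeasure_percolationLaw (M := M) hr0.le hr1
  have hMqr : 1 < M * (q * r) := by
    rw [hr, Real.rpow_neg hM0.le, ← mul_assoc, ← div_eq_mul_inv, one_lt_div (by positivity)]
    exact hsq
  set A : Set (List (Fin M) → Set (Fin M)) := {T | thinnedSurvival r T = 0} with hA
  have hAm : MeasurableSet A := measurable_thinnedSurvival hr0.le hr1 (measurableSet_singleton 0)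
  have hSm : MeasurableSet {T : List (Fin M) → Set (Fin M) | ¬ Survives T} :=
    measurableSet_survives.compl
  have hprod : IsFractalPercolation (P.prod (percolationLaw M r)) M (q * r)
      (fun σ x => I σ x.1 ∩ x.2 σ) :=
    (h.comp_measurePreserving measurePreserving_fst).inter hq0.le
      ((isFractalPercolation_percolationLaw hr0.le hr1).comp_measurePreserving
        measurePreserving_snd) (indepFun_prod h.measurable_pi measurable_id)
  have hpos := hprod.measure_survives_pos (mul_pos hq0 hr0)
    (mul_le_one₀ hq1 hr0.le hr1) hMqr
  have hsub : {ω | (fun σ => I σ ω) ∈ {T : List (Fin M) → Set (Fin M) | ¬ Survives T}} ⊆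
      {ω | (fun σ => I σ ω) ∈ A} := by
    intro ω hω
    refine measure_mono_null (fun T' hT' => ?_) measure_empty
    exact hω fun n => (hT' n).mono (generation_mono (fun _ => inter_subset_left) n)
  -- Otherwise, by Fubini, the supercritical percolation on the product space would almost surely
  -- die.
  have hg1 : P.real {ω | (fun σ => I σ ω) ∈ A} < 1 := by
    refine lt_of_le_of_ne measureReal_le_one fun h1 => hpos.ne' ?_
    rw [measureReal_def, ENNReal.toReal_eq_one_iff] at h1
    have hae : ∀ᵐ ω ∂P, thinnedSurvival r (fun σ => I σ ω) = 0 :=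
      (mem_ae_iff_prob_eq_one (h.measurable_pi hAm)).2 h1
    have hm : MeasurableSet {x : Ω × (List (Fin M) → Set (Fin M)) |
        Survives fun σ => I σ x.1 ∩ x.2 σ} := hprod.measurable_pi measurableSet_survives
    rw [Measure.measure_prod_null hm]
    exact hae
  have heq := fixedPoint_unique hM hq0 hq1 measureReal_nonneg (measureReal_mono hsub) hg1
    (h.fixedPoint_of_inherited hq0.le hq1 hSm fun T => not_survives_iff)
    (h.fixedPoint_of_inherited hq0.le hq1 hAm fun T => thinnedSurvival_eq_zero_iff hr0 hr1 T)
  -- Extinction is contained in the event `A` and has the same probability, so the two differ by a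
  -- null set.
  have hdiff : P ({ω | (fun σ => I σ ω) ∈ A} \
      {ω | (fun σ => I σ ω) ∈ {T : List (Fin M) → Set (Fin M) | ¬ Survives T}}) = 0 := by
    rw [measure_sdiff hsub (h.measurable_pi hSm).nullMeasurableSet (measure_ne_top _ _),
      ← ofReal_measureReal, ← ofReal_measureReal, heq, tsub_self]
  filter_upwards [measure_eq_zero_iff_ae_notMem.1 hdiff] with ω hω hsurv
  refine hausdorffMeasure_limitSet_ne_zero hM hs fun h0 => hω ⟨h0, fun hns => hns hsurv⟩

/-! ### Upper bound: first moment. -/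

/-- The sum of the t-th powers of the diameters over generation n has mean (Mq / Mᵗ)ⁿ → 0; by
Fatou's lemma its lower limit vanishes almost surely, and this limit bounds the Hausdorff measure.
-/
theorem IsFractalPercolation.ae_hausdorffMeasure_eq_zero (hM : 2 ≤ M) (hq0 : 0 ≤ q) (hq1 : q ≤ 1)
    (h : IsFractalPercolation P M q I) {t : ℝ} (ht : 0 < t) (htq : M * q < (M : ℝ) ^ t) :
    ∀ᵐ ω ∂P, μH[t] (limitSet fun σ => I σ ω) = 0 := by
  classical
  have hM1 : (1 : ℝ) < M := by exact_mod_cast hM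
  have hM0 : (0 : ℝ) < M := by linarith
  set F : ℕ → Ω → ℝ≥0∞ := fun n ω => ∑ σ : List.Vector (Fin M) n,
    {ω | σ.toList ∈ generation (fun τ => I τ ω) n}.indicator
      (fun _ => ENNReal.ofReal ((M : ℝ)⁻¹ ^ n) ^ t) ω with hF
  have hGm : ∀ n (σ : List.Vector (Fin M) n),
      MeasurableSet {ω | σ.toList ∈ generation (fun τ => I τ ω) n} := fun n σ =>
    h.measurable_pi (measurableSet_mem_generation σ.toList n)
  have hFm : ∀ n, Measurable (F n) := fun n =>
    Finset.measurable_sum _ fun σ _ => measurable_const.indicator (hGm n σ)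
  have hint : ∀ n, ∫⁻ ω, F n ω ∂P = ENNReal.ofReal (M * q / (M : ℝ) ^ t) ^ n := by
    intro n
    rw [hF, lintegral_finsetSum _ fun σ _ => measurable_const.indicator (hGm n σ)]
    have hone : ∀ σ : List.Vector (Fin M) n,
        ∫⁻ ω, {ω | σ.toList ∈ generation (fun τ => I τ ω) n}.indicator
          (fun _ => ENNReal.ofReal ((M : ℝ)⁻¹ ^ n) ^ t) ω ∂P =
        ENNReal.ofReal ((M : ℝ)⁻¹ ^ n) ^ t * ENNReal.ofReal q ^ n := by
      intro σ
      rw [lintegral_indicator_const (hGm n σ)]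
      have := h.measure_mem_generation hq0 hq1 σ.toList
      rw [List.Vector.toList_length] at this
      rw [this]
    simp only [hone, Finset.sum_const, Finset.card_univ, card_vector, Fintype.card_fin,
      nsmul_eq_mul]
    rw [ENNReal.ofReal_rpow_of_pos (by positivity), ← ENNReal.ofReal_pow hq0,
      ← ENNReal.ofReal_mul (by positivity), ← ENNReal.ofReal_natCast,
      ← ENNReal.ofReal_mul (by positivity), ← ENNReal.ofReal_pow (by positivity)]
    congr 1
    rw [← Real.rpow_natCast_mul (by positivity), mul_comm (n : ℝ) t,
      Real.rpow_mul_natCast (by positivity), Real.inv_rpow hM0.le]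
    push_cast
    rw [div_pow, mul_pow, inv_pow]
    ring
  have hlim : Tendsto (fun n => ∫⁻ ω, F n ω ∂P) atTop (𝓝 0) := by
    simp only [hint]
    refine ENNReal.tendsto_pow_atTop_nhds_zero_of_lt_one (ENNReal.ofReal_lt_one.2 ?_)
    rwa [div_lt_one (by positivity)]
  have hzero : ∫⁻ ω, liminf (fun n => F n ω) atTop ∂P = 0 :=
    le_antisymm ((lintegral_liminf_le hFm).trans hlim.liminf_eq.le) zero_le
  rw [lintegral_eq_zero_iff (Measurable.liminf hFm)] at hzero
  filter_upwards [hzero] with ω hω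
  -- The cover is indexed by all words of length n; absent words get `∅`, which contributes 0
  -- because t > 0.
  set U : ∀ n, List.Vector (Fin M) n → Set ℝ := fun n σ =>
    if σ.toList ∈ generation (fun τ => I τ ω) n then basicInterval M σ.toList else ∅ with hU
  have hdiam : ∀ n (σ : List.Vector (Fin M) n),
      Metric.ediam (basicInterval M σ.toList) = ENNReal.ofReal ((M : ℝ)⁻¹ ^ n) := by
    intro n σ
    rw [basicInterval_eq (by omega), Real.ediam_Icc, List.Vector.toList_length]
    congr 1
    rw [← sub_div, add_sub_cancel_left, inv_pow, one_div]
  refine le_antisymm ?_ zero_le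
  calc μH[t] (limitSet fun σ => I σ ω)
      ≤ liminf (fun n => ∑ σ, Metric.ediam (U n σ) ^ t) atTop := by
        refine Measure.hausdorffMeasure_le_liminf_sum t _ (fun n => ENNReal.ofReal ((M : ℝ)⁻¹ ^ n))
          ?_ U (Eventually.of_forall fun n σ => ?_) (Eventually.of_forall fun n x hx => ?_)
        · have := (tendsto_pow_atTop_nhds_zero_of_lt_one (inv_nonneg.2 hM0.le)
            (inv_lt_one_of_one_lt₀ hM1))
          simpa using ENNReal.tendsto_ofReal this
        · simp only [hU]
          split_ifs
          · exact (hdiam n σ).le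
          · simp
        · obtain ⟨σ, hσ, hxσ⟩ := mem_iUnion₂.1 (mem_iInter.1 hx n)
          refine mem_iUnion.2 ⟨⟨σ, length_of_mem_generation hσ⟩, ?_⟩
          simp only [hU]
          rw [if_pos]
          · exact hxσ
          · exact hσ
    _ = liminf (fun n => F n ω) atTop := by
        congr 1
        ext n
        refine Finset.sum_congr rfl fun σ _ => ?_
        simp only [hU, indicator, mem_ofPred_eq]
        split_ifs
        · rw [hdiam]
        · simp [ht]
    _ = 0 := hω

/-! ### From Hausdorff measures to Hausdorff dimension. -/

theorem rpow_lt_iff_lt_log_div {M : ℕ} (hM : 2 ≤ M) {a s : ℝ} (ha : 0 < a) :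
    (M : ℝ) ^ s < a ↔ s < Real.log a / Real.log M := by
  have hM1 : (1 : ℝ) < M := by exact_mod_cast hM
  rw [Real.rpow_lt_iff_lt_log (by linarith) ha, lt_div_iff₀ (Real.log_pos hM1)]

theorem lt_rpow_iff_log_div_lt {M : ℕ} (hM : 2 ≤ M) {a s : ℝ} (ha : 0 < a) :
    a < (M : ℝ) ^ s ↔ Real.log a / Real.log M < s := by
  have hM1 : (1 : ℝ) < M := by exact_mod_cast hM
  rw [Real.lt_rpow_iff_log_lt ha (by linarith), div_lt_iff₀ (Real.log_pos hM1)]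

theorem IsFractalPercolation.ae_le_dimH (hM : 2 ≤ M) (hq0 : 0 < q) (hq1 : q ≤ 1)
    (h : IsFractalPercolation P M q I) :
    ∀ᵐ ω ∂P, Survives (fun σ => I σ ω) →
      ENNReal.ofReal (Real.log (M * q) / Real.log M) ≤ dimH (limitSet fun σ => I σ ω) := by
  have hMq : 0 < M * q := mul_pos (by exact_mod_cast (by omega : 0 < M)) hq0
  -- Rational exponents suffice and allow one null set to serve for all of them.
  have hall : ∀ᵐ ω ∂P, ∀ s : ℚ, 0 < (s : ℝ) → (s : ℝ) < Real.log (M * q) / Real.log M →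
      Survives (fun σ => I σ ω) → μH[s] (limitSet fun σ => I σ ω) ≠ 0 := by
    rw [ae_all_iff]
    intro s
    by_cases hs : 0 < (s : ℝ) ∧ (s : ℝ) < Real.log (M * q) / Real.log M
    · filter_upwards [h.ae_hausdorffMeasure_ne_zero hM hq0 hq1 hs.1
        ((rpow_lt_iff_lt_log_div hM hMq).2 hs.2)] with ω hω _ _ using hω
    · exact Eventually.of_forall fun ω h1 h2 => absurd ⟨h1, h2⟩ hs
  filter_upwards [hall] with ω hω hsurv
  refine le_of_forall_lt fun a ha => ?_
  have hatop : a ≠ ∞ := ne_top_of_lt ha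
  have ha' : a.toReal < Real.log (M * q) / Real.log M := by
    rwa [ENNReal.lt_ofReal_iff_toReal_lt hatop] at ha
  obtain ⟨s, hs1, hs2⟩ := exists_rat_btwn ha'
  have hs0 : 0 < (s : ℝ) := lt_of_le_of_lt ENNReal.toReal_nonneg hs1
  have hdim := le_dimH_of_hausdorffMeasure_ne_zero (d := (s : ℝ).toNNReal)
    (s := limitSet fun σ => I σ ω) (by
      rw [Real.coe_toNNReal _ hs0.le]; exact hω s hs0 hs2 hsurv)
  refine lt_of_lt_of_le ?_ hdim
  rw [← ENNReal.ofReal_toReal hatop]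
  exact (ENNReal.ofReal_lt_ofReal_iff hs0).2 hs1

theorem IsFractalPercolation.ae_dimH_le (hM : 2 ≤ M) (hq0 : 0 < q) (hq1 : q ≤ 1)
    (h : IsFractalPercolation P M q I) :
    ∀ᵐ ω ∂P, dimH (limitSet fun σ => I σ ω) ≤
      ENNReal.ofReal (Real.log (M * q) / Real.log M) := by
  have hMq : 0 < M * q := mul_pos (by exact_mod_cast (by omega : 0 < M)) hq0
  have hall : ∀ᵐ ω ∂P, ∀ t : ℚ, 0 < (t : ℝ) → Real.log (M * q) / Real.log M < (t : ℝ) →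
      μH[t] (limitSet fun σ => I σ ω) = 0 := by
    rw [ae_all_iff]
    intro t
    by_cases ht : 0 < (t : ℝ) ∧ Real.log (M * q) / Real.log M < (t : ℝ)
    · filter_upwards [h.ae_hausdorffMeasure_eq_zero hM hq0.le hq1 ht.1
        ((lt_rpow_iff_log_div_lt hM hMq).2 ht.2)] with ω hω _ _ using hω
    · exact Eventually.of_forall fun ω h1 h2 => absurd ⟨h1, h2⟩ ht
  filter_upwards [hall] with ω hω
  refine le_of_forall_gt fun a ha => ?_
  rcases eq_or_ne a ∞ with rfl | hatop
  · exact Real.dimH_lt_top _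
  -- The maximum with 0 covers a negative quotient, which `ENNReal.ofReal` truncates to 0, and keeps
  -- the rational exponent positive.
  have ha' : max (Real.log (M * q) / Real.log M) 0 < a.toReal := by
    have hpos : 0 < a.toReal := ENNReal.toReal_pos (ne_bot_of_gt ha) hatop
    refine max_lt ?_ hpos
    rwa [← ENNReal.ofReal_toReal hatop, ENNReal.ofReal_lt_ofReal_iff hpos] at ha
  obtain ⟨t, ht1, ht2⟩ := exists_rat_btwn ha'
  rw [max_lt_iff] at ht1
  have hdim := dimH_le_of_hausdorffMeasure_ne_top (d := (t : ℝ).toNNReal)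
    (s := limitSet fun σ => I σ ω) (by
      rw [Real.coe_toNNReal _ ht1.2.le, hω t ht1.2 ht1.1]; simp)
  refine lt_of_le_of_lt hdim ?_
  rw [← ENNReal.ofReal_toReal hatop]
  exact (ENNReal.ofReal_lt_ofReal_iff (ht1.2.trans ht2)).2 ht2

/-! ### The intersection of two percolations. -/

theorem IsFractalPercolation.ae_limitSet_inter_eq (hM : 2 ≤ M) (hq0 : 0 ≤ q) (hq1 : q < 1)
    (h : IsFractalPercolation P M q I) (I' : List (Fin M) → Ω → Set (Fin M)) :
    ∀ᵐ ω ∂P, limitSet (fun σ => I σ ω) ∩ limitSet (fun σ => I' σ ω) =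
      limitSet fun σ => I σ ω ∩ I' σ ω := by
  have hrat : ∀ᵐ ω ∂P, ∀ u : ℚ, (u : ℝ) ∉ limitSet (fun σ => I σ ω) :=
    ae_all_iff.2 fun u => measure_eq_zero_iff_ae_notMem.1
      (h.measure_hit_singleton (by omega) hq0 hq1 u)
  filter_upwards [hrat] with ω hω
  exact Subset.antisymm (limitSet_inter_subset (by omega) hω)
    (subset_inter (limitSet_mono fun _ => inter_subset_left)
      (limitSet_mono fun _ => inter_subset_right))

theorem IsFractalPercolation.ae_survives_of_eq_one (hM : 0 < M)
    (h : IsFractalPercolation P M q I) (hq : q = 1) :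
    ∀ᵐ ω ∂P, Survives (fun σ => I σ ω) := by
  have hall : ∀ᵐ ω ∂P, ∀ e : List (Fin M) × Fin M, e.2 ∈ I e.1 ω := by
    rw [ae_all_iff]
    intro e
    refine (mem_ae_iff_prob_eq_one (h.measurableSet_mem e.1 e.2)).2 ?_
    rw [h.prob_mem, hq, ENNReal.ofReal_one]
  filter_upwards [hall] with ω hω n
  induction n with
  | zero => exact ⟨[], rfl⟩
  | succ n ih =>
    obtain ⟨σ, hσ⟩ := ih
    exact ⟨σ ++ [⟨0, hM⟩], σ, hσ, _, hω (σ, _), rfl⟩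

/-- Compactness reduces nonemptiness to the finite levels, where it is a countable union over pairs
of words whose intervals meet. -/
theorem measurableSet_inter_nonempty (hM : 0 < M) {I' : List (Fin M) → Ω → Set (Fin M)}
    (hI : Measurable fun ω σ => I σ ω) (hI' : Measurable fun ω σ => I' σ ω) :
    MeasurableSet
      {ω | (limitSet (fun σ => I σ ω) ∩ limitSet (fun σ => I' σ ω)).Nonempty} := by
  have hset : {ω | (limitSet (fun σ => I σ ω) ∩ limitSet (fun σ => I' σ ω)).Nonempty} =
      ⋂ n, ⋃ σ, ⋃ τ, ⋃ _ : (basicInterval M σ ∩ basicInterval M τ).Nonempty,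
        {ω | σ ∈ generation (fun σ => I σ ω) n} ∩ {ω | τ ∈ generation (fun σ => I' σ ω) n} := by
    ext ω
    simp only [mem_ofPred_eq, limitSet_inter_nonempty_iff hM, mem_iInter, mem_iUnion, mem_inter_iff,
      exists_prop]
    refine forall_congr' fun n => ⟨?_, ?_⟩
    · rintro ⟨x, hx, hx'⟩
      obtain ⟨σ, hσ, hxσ⟩ := mem_iUnion₂.1 hx
      obtain ⟨τ, hτ, hxτ⟩ := mem_iUnion₂.1 hx'
      exact ⟨σ, τ, ⟨x, hxσ, hxτ⟩, hσ, hτ⟩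
    · rintro ⟨σ, τ, ⟨x, hxσ, hxτ⟩, hσ, hτ⟩
      exact ⟨x, mem_iUnion₂.2 ⟨σ, hσ, hxσ⟩, mem_iUnion₂.2 ⟨τ, hτ, hxτ⟩⟩
  rw [hset]
  exact MeasurableSet.iInter fun n => MeasurableSet.iUnion fun σ => MeasurableSet.iUnion fun τ =>
    MeasurableSet.iUnion fun _ => (hI (measurableSet_mem_generation σ n)).inter
      (hI' (measurableSet_mem_generation τ n))

end FractalPercolation

open FractalPercolation in
/-- For independent fractal percolations `K₁`, `K₂` on `[0,1]` with the same parameters `M ≥ 2`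
and `p ∈ [0,1]`, the intersection `K₁ ∩ K₂` is almost surely empty if `p ≤ 1/√M`; if `p > 1/√M`,
it is nonempty with positive probability, and conditioned on being nonempty its Hausdorff
dimension is almost surely `log (M p²) / log M`. -/
theorem mainTheorem9 {Ω : Type*} [MeasurableSpace Ω] (P : MeasureTheory.Measure Ω)
    [MeasureTheory.IsProbabilityMeasure P]
    (M : ℕ) (hM : 2 ≤ M) (p : ℝ) (hp0 : 0 ≤ p) (hp1 : p ≤ 1)
    (I₁ I₂ : List (Fin M) → Ω → Set (Fin M))
    (h₁ : FractalPercolation.IsFractalPercolation P M p I₁)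
    (h₂ : FractalPercolation.IsFractalPercolation P M p I₂)
    (hindep : ProbabilityTheory.IndepFun (fun ω σ => I₁ σ ω) (fun ω σ => I₂ σ ω) P)
    (K₁ K₂ : Ω → Set ℝ)
    (hK₁ : ∀ ω, K₁ ω = FractalPercolation.limitSet (fun σ => I₁ σ ω))
    (hK₂ : ∀ ω, K₂ ω = FractalPercolation.limitSet (fun σ => I₂ σ ω)) :
    (p ≤ 1 / √(M : ℝ) → ∀ᵐ ω ∂P, K₁ ω ∩ K₂ ω = ∅) ∧
    (1 / √(M : ℝ) < p →
      MeasurableSet {ω | (K₁ ω ∩ K₂ ω).Nonempty} ∧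
      0 < P {ω | (K₁ ω ∩ K₂ ω).Nonempty} ∧
      ∀ᵐ ω ∂(ProbabilityTheory.cond P {ω | (K₁ ω ∩ K₂ ω).Nonempty}),
        dimH (K₁ ω ∩ K₂ ω) = ENNReal.ofReal (Real.log (M * p ^ 2) / Real.log M)) := by
  obtain rfl : K₁ = fun ω => limitSet (fun σ => I₁ σ ω) := funext hK₁
  obtain rfl : K₂ = fun ω => limitSet (fun σ => I₂ σ ω) := funext hK₂
  have hMpos : 0 < M := by omega
  have hM1 : (1 : ℝ) < M := by exact_mod_cast hM
  have hM0 : (0 : ℝ) < M := by linarith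
  have hsq : 0 < √(M : ℝ) := Real.sqrt_pos.2 hM0
  have hJ : IsFractalPercolation P M (p ^ 2) (fun σ ω => I₁ σ ω ∩ I₂ σ ω) := by
    rw [sq]; exact h₁.inter hp0 h₂ hindep
  have hq1 : p ^ 2 ≤ 1 := pow_le_one₀ hp0 hp1
  -- Turns the threshold p = 1/√M into the criticality condition M p² = 1.
  have hmul : (p * √(M : ℝ)) ^ 2 = M * p ^ 2 := by
    rw [mul_pow, Real.sq_sqrt hM0.le, mul_comm]
  refine ⟨fun hp => ?_, fun hp => ?_⟩
  · have hlt : p < 1 := hp.trans_lt (by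
      rw [div_lt_one hsq]; exact Real.lt_sqrt_of_sq_lt (by simpa using hM1))
    rw [le_div_iff₀ hsq] at hp
    have hMq : M * p ^ 2 ≤ 1 := by
      rw [← hmul]; exact pow_le_one₀ (by positivity) hp
    filter_upwards [h₁.ae_limitSet_inter_eq hM hp0 hlt I₂,
      hJ.ae_not_survives hM (sq_nonneg p) hq1 hMq] with ω heq hns
    rw [heq, ← Set.not_nonempty_iff_eq_empty, limitSet_nonempty_iff hMpos]
    exact hns
  · have hp_pos : 0 < p := lt_trans (by positivity) hp
    rw [div_lt_iff₀ hsq] at hp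
    have hq0 : 0 < p ^ 2 := by positivity
    have hMq : 1 < M * p ^ 2 := by
      rw [← hmul]; exact one_lt_pow₀ hp two_ne_zero
    have hsub : ∀ ω, limitSet (fun σ => I₁ σ ω ∩ I₂ σ ω) ⊆
        limitSet (fun σ => I₁ σ ω) ∩ limitSet (fun σ => I₂ σ ω) := fun ω =>
      Set.subset_inter (limitSet_mono fun _ => Set.inter_subset_left)
        (limitSet_mono fun _ => Set.inter_subset_right)
    refine ⟨measurableSet_inter_nonempty hMpos h₁.measurable_pi h₂.measurable_pi, ?_, ?_⟩
    · refine (hJ.measure_survives_pos hq0 hq1 hMq).trans_le (MeasureTheory.measure_mono ?_)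
      exact fun ω hω => ((limitSet_nonempty_iff hMpos _).2 hω).mono (hsub ω)
    · have hmeas := measurableSet_inter_nonempty hMpos h₁.measurable_pi h₂.measurable_pi
      suffices hae : ∀ᵐ ω ∂P,
          (limitSet (fun σ => I₁ σ ω) ∩ limitSet (fun σ => I₂ σ ω)).Nonempty →
          dimH (limitSet (fun σ => I₁ σ ω) ∩ limitSet (fun σ => I₂ σ ω)) =
            ENNReal.ofReal (Real.log (M * p ^ 2) / Real.log M) by
        filter_upwards [ProbabilityTheory.cond_absolutelyContinuous.ae_le hae,
          ProbabilityTheory.ae_cond_mem hmeas] with ω hω hne using hω hne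
      -- For p = 1 rational points are not avoided, so the limit set of the intersected tree serves
      -- only as a subset: it gives dimension at least 1, and the line gives at most 1.
      rcases hp1.eq_or_lt with h1 | hlt
      · filter_upwards [hJ.ae_le_dimH hM hq0 hq1,
          hJ.ae_survives_of_eq_one hMpos (by rw [h1, one_pow])] with ω hle hsurv _
        refine le_antisymm ?_ ((hle hsurv).trans (dimH_mono (hsub ω)))
        rw [h1, one_pow, mul_one, div_self (Real.log_pos hM1).ne', ENNReal.ofReal_one,
          ← Real.dimH_univ]
        exact dimH_mono (Set.subset_univ _)
      · filter_upwards [hJ.ae_le_dimH hM hq0 hq1, hJ.ae_dimH_le hM hq0 hq1,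
          h₁.ae_limitSet_inter_eq hM hp0 hlt I₂] with ω hle hge heq hne
        rw [heq] at hne ⊢
        exact le_antisymm hge (hle ((limitSet_nonempty_iff hMpos _).1 hne))
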